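/- Let $N\ge 1$, let $\Omega\subseteq\mathbb R^N$ be an open set (bounded or not, possibly all of $\mathbb R^N$), and let $T>0$, $q>1$ and $\alpha>-1$. Let $u$ be a real-valued (not necessarily nonnegative) classical solution of $$\partial_t u-\Delta u+t^{\alpha}|u|^{q-1}u=0\quad\text{in }\Omega\times(0,T),$$ that is, $u\in C^{2,1}(\Omega\times(0,T))$ ($u$, $\partial_t u$, $D_xu$ and $D_x^2u$ are continuous in $\Omega\times(0,T)$) and the equation holds at every point. Assume that $u$ is continuous on $\overline\Omega\times(0,T)$ and vanishes on the lateral boundary $\partial\Omega\times(0,T)$; no condition is imposed on $u$ at $t=0$, where it may be singular. Then $$u(x,t)\le c_\alpha\, t^{-\frac{1+\alpha}{q-1}}\quad\text{for all }(x,t)\in\Omega\times(0,T),\qquad c_\alpha=\Big(\frac{1+\alpha}{q-1}\Big)^{\frac1{q-1}}.$$ -/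

import Mathlib

/-- `u ∈ C^{2,1}(Ω × (0,T))`: the function `u`, its time derivative and its space derivatives of
order one and two exist and are jointly continuous in `Ω × (0,T)`. -/
structure IsC21 {N : ℕ} (Ω : Set (EuclideanSpace ℝ (Fin N))) (T : ℝ)
    (u : EuclideanSpace ℝ (Fin N) → ℝ → ℝ) : Prop where
  /-- each time slice is twice continuously differentiable in space -/
  contDiffOn_space : ∀ t ∈ Set.Ioo 0 T, ContDiffOn ℝ 2 (fun y => u y t) Ω
  /-- the time derivative exists -/
  differentiableAt_time : ∀ x ∈ Ω, ∀ t ∈ Set.Ioo 0 T, DifferentiableAt ℝ (fun s => u x s) t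
  /-- `u`, `D_x u` and `D_x^2 u` (`k = 0, 1, 2`) are jointly continuous -/
  continuousOn_space : ∀ k : ℕ, k ≤ 2 → ContinuousOn
    (fun p : EuclideanSpace ℝ (Fin N) × ℝ => iteratedFDeriv ℝ k (fun y => u y p.2) p.1)
    (Ω ×ˢ Set.Ioo 0 T)
  /-- `∂_t u` is jointly continuous -/
  continuousOn_time : ContinuousOn
    (fun p : EuclideanSpace ℝ (Fin N) × ℝ => deriv (fun s => u p.1 s) p.2)
    (Ω ×ˢ Set.Ioo 0 T)

/-- `u` is a (classical) solution of `∂_t u - Δ u + t^α |u|^{q-1} u = 0` in `Ω × (0,T)`. -/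
structure IsSolution {N : ℕ} (Ω : Set (EuclideanSpace ℝ (Fin N))) (T α q : ℝ)
    (u : EuclideanSpace ℝ (Fin N) → ℝ → ℝ) : Prop where
  /-- `u` is of class `C^{2,1}` -/
  isC21 : IsC21 Ω T u
  /-- the equation holds at every point -/
  equation : ∀ x ∈ Ω, ∀ t ∈ Set.Ioo 0 T,
    deriv (fun s => u x s) t - Laplacian.laplacian (fun y => u y t) x
      + t ^ α * |u x t| ^ (q - 1) * u x t = 0

/-- `u` is continuous up to the lateral boundary `∂Ω × (0,T)` and vanishes there. Nothing is asked
of `u` at `t = 0`, where it may be singular. -/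
structure VanishesOnLateralBoundary {N : ℕ} (Ω : Set (EuclideanSpace ℝ (Fin N))) (T : ℝ)
    (u : EuclideanSpace ℝ (Fin N) → ℝ → ℝ) : Prop where
  /-- `u` is continuous on the closure of `Ω` times `(0,T)` -/
  continuousOn : ContinuousOn (fun p : EuclideanSpace ℝ (Fin N) × ℝ => u p.1 p.2)
    (closure Ω ×ˢ Set.Ioo 0 T)
  /-- `u = 0` on the lateral boundary -/
  eq_zero : ∀ x ∈ frontier Ω, ∀ t ∈ Set.Ioo 0 T, u x t = 0

/-! Fix `τ > 0`. The spatially constant solution of `y' + t^α y^q = 0` that is infinite at `τ`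
should dominate `u` after `τ`, whatever the behaviour of `u` near `t = 0`. As `Ω` may be unbounded,
a Keller–Osserman function `w`, infinite on a sphere of radius `R` centred at the point under study,
is added to control `u` far away. Since `(a + b)^q ≥ a^q + b^q` for `a, b ≥ 0`, the sum `y + w` is
again a supersolution, and the maximum principle gives `u ≤ y + w` (`IsSolution.le_add_of_blowup`).
At the centre `w` tends to `0` as `R → ∞` (`IsSolution.le_blowup_ode`); letting `τ → 0` then gives
the bound. -/

open Filter Topology in
/-- At a local maximum the second derivative is nonpositive. -/
theorem IsLocalMax.deriv_deriv_nonpos {f : ℝ → ℝ} {a : ℝ} (h : IsLocalMax f a)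
    (hc : ContinuousAt f a) : deriv (deriv f) a ≤ 0 := by
  by_contra! hpos
  -- A maximum that is also a minimum makes `f` locally constant, so its second derivative vanishes.
  have hmin := isLocalMin_of_deriv_deriv_pos hpos h.deriv_eq_zero hc
  have heq : f =ᶠ[𝓝 a] fun _ => f a := by
    filter_upwards [h, hmin] with s h1 h2 using le_antisymm h1 h2
  have := heq.deriv.deriv_eq
  simp [this] at hpos

open Filter Topology in
/-- If `f` does not exceed `f t` just to the left of `t`, then the derivative at `t` is
nonnegative. -/
theorem HasDerivAt.nonneg_of_eventually_nhdsLT_le {f : ℝ → ℝ} {f' t : ℝ} (h : HasDerivAt f f' t)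
    (hle : ∀ᶠ s in 𝓝[<] t, f s ≤ f t) : 0 ≤ f' := by
  have h1 : Tendsto (slope f t) (𝓝[<] t) (𝓝 f') :=
    (hasDerivAt_iff_tendsto_slope.1 h).mono_left (nhdsWithin_mono _ fun s hs => ne_of_lt hs)
  refine ge_of_tendsto h1 ?_
  filter_upwards [hle, self_mem_nhdsWithin] with s hs hst
  rw [slope_def_field]
  exact div_nonneg_of_nonpos (by linarith) (by have : s < t := hst; linarith)

/-! ### The Laplacian along lines and of the radial barrier -/

section Laplacian

variable {E : Type*} [NormedAddCommGroup E] [InnerProductSpace ℝ E]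

/-- The second derivative along a line, expressed by the second Fréchet derivative. -/
theorem ContDiffAt.deriv_deriv_comp_line {g : E → ℝ} {x : E} (hg : ContDiffAt ℝ 2 g x) (e : E) :
    deriv (deriv fun s : ℝ => g (x + s • e)) 0 = iteratedFDeriv ℝ 2 g x ![e, e] := by
  have hline : ∀ s : ℝ, HasDerivAt (fun s : ℝ => x + s • e) e s := fun s => by
    simpa using ((hasDerivAt_id s).smul_const e).const_add x
  have hcont : Filter.Tendsto (fun s : ℝ => x + s • e) (nhds 0) (nhds x) := by
    simpa using (hline 0).continuousAt.tendsto
  have h1 : (deriv fun s : ℝ => g (x + s • e)) =ᶠ[nhds 0] fun s => fderiv ℝ g (x + s • e) e := by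
    filter_upwards [hcont.eventually (hg.eventually (by simp))] with s hs
    exact (HasFDerivAt.comp_hasDerivAt (f := fun s : ℝ => x + s • e) s
      (hs.differentiableAt (by simp)).hasFDerivAt (hline s)).deriv
  have hd : DifferentiableAt ℝ (fderiv ℝ g) x :=
    (hg.fderiv_right (m := 1) (by norm_num)).differentiableAt (by simp)
  have h2 : HasFDerivAt (fderiv ℝ g) (fderiv ℝ (fderiv ℝ g) x) (x + (0 : ℝ) • e) := by
    simpa using hd.hasFDerivAt
  have h3 : HasDerivAt (fun s : ℝ => fderiv ℝ g (x + s • e)) (fderiv ℝ (fderiv ℝ g) x e) 0 :=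
    HasFDerivAt.comp_hasDerivAt (f := fun s : ℝ => x + s • e) 0 h2 (hline 0)
  have h4 : HasDerivAt (fun s : ℝ => fderiv ℝ g (x + s • e) e) (fderiv ℝ (fderiv ℝ g) x e e) 0 :=
    (ContinuousLinearMap.apply ℝ ℝ e).hasFDerivAt.comp_hasDerivAt (0 : ℝ) h3
  rw [h1.deriv_eq, iteratedFDeriv_two_apply, h4.deriv]
  rfl

/-- The radial barrier restricted to a line with unit direction `e` has this form, with `a = R² - |x
- x₀|²` and `b = ⟨x - x₀, e⟩`. -/
theorem deriv_deriv_rpow_quadratic {a k : ℝ} (ha : 0 < a) (A b : ℝ) :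
    deriv (deriv fun s : ℝ => A * (a - 2 * s * b - s ^ 2) ^ (-k)) 0 =
      A * (2 * k * a ^ (-k - 1) + 4 * k * (k + 1) * b ^ 2 * a ^ (-k - 2)) := by
  have hp : ∀ s : ℝ, HasDerivAt (fun s : ℝ => a - 2 * s * b - s ^ 2) (-(2 * b) - 2 * s) s := by
    intro s
    have h1 := (((hasDerivAt_id s).const_mul 2).mul_const b).const_sub a
    have h2 := h1.fun_sub (hasDerivAt_pow 2 s)
    convert! h2 using 1
    simp
  have hpos : ∀ᶠ s : ℝ in nhds 0, 0 < a - 2 * s * b - s ^ 2 :=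
    (hp 0).continuousAt.eventually (lt_mem_nhds (by simpa using ha))
  have h1 : (deriv fun s : ℝ => A * (a - 2 * s * b - s ^ 2) ^ (-k)) =ᶠ[nhds 0]
      fun s => A * ((-(2 * b) - 2 * s) * (-k) * (a - 2 * s * b - s ^ 2) ^ (-k - 1)) := by
    filter_upwards [hpos] with s hs
    exact (((hp s).rpow_const (Or.inl hs.ne')).const_mul A).deriv
  rw [h1.deriv_eq]
  have hl : HasDerivAt (fun s : ℝ => (-(2 * b) - 2 * s) * (-k)) (-2 * (-k)) 0 := by
    simpa using (((hasDerivAt_id (0 : ℝ)).const_mul 2).const_sub (-(2 * b))).mul_const (-k)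
  have h2 := (hl.fun_mul ((hp 0).rpow_const (p := -k - 1) (Or.inl (by simpa using ha.ne')))).const_mul A
  have h3 : -k - 1 - 1 = -k - 2 := by ring
  rw [HasDerivAt.deriv h2]
  simp only [h3, mul_zero, zero_mul, sub_zero, ne_eq, OfNat.ofNat_ne_zero, not_false_eq_true,
    zero_pow]
  ring

theorem contDiffAt_rpow_sq_sub_norm_sq {x₀ x : E} {R : ℝ} (hx : ‖x - x₀‖ < R) (A k : ℝ) :
    ContDiffAt ℝ 2 (fun y => A * (R ^ 2 - ‖y - x₀‖ ^ 2) ^ (-k)) x := by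
  have hpos : 0 < R ^ 2 - ‖x - x₀‖ ^ 2 := by
    have := norm_nonneg (x - x₀)
    nlinarith
  have h1 : ContDiffAt ℝ 2 (fun y => R ^ 2 - ‖y - x₀‖ ^ 2) x :=
    contDiffAt_const.sub ((contDiff_norm_sq ℝ).contDiffAt.comp x (contDiffAt_id.sub contDiffAt_const))
  exact contDiffAt_const.mul (h1.rpow_const_of_ne hpos.ne')

variable [FiniteDimensional ℝ E]

/-- The Laplacian as a sum of second derivatives along the lines of an orthonormal basis. -/
theorem ContDiffAt.laplacian_eq_sum_deriv_deriv {ι : Type*} [Fintype ι]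
    (v : OrthonormalBasis ι ℝ E) {g : E → ℝ} {x : E} (hg : ContDiffAt ℝ 2 g x) :
    Laplacian.laplacian g x = ∑ i, deriv (deriv fun s : ℝ => g (x + s • v i)) 0 := by
  rw [InnerProductSpace.laplacian_eq_iteratedFDeriv_orthonormalBasis g v]
  exact Finset.sum_congr rfl fun i _ => (hg.deriv_deriv_comp_line (v i)).symm

/-- At a local maximum the Laplacian is nonpositive. -/
theorem IsLocalMax.laplacian_nonpos {g : E → ℝ} {x : E} (h : IsLocalMax g x)
    (hg : ContDiffAt ℝ 2 g x) : Laplacian.laplacian g x ≤ 0 := by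
  rw [hg.laplacian_eq_sum_deriv_deriv (stdOrthonormalBasis ℝ E)]
  refine Finset.sum_nonpos fun i _ => ?_
  have hc : ContinuousAt (fun s : ℝ => x + s • stdOrthonormalBasis ℝ E i) 0 := by fun_prop
  refine IsLocalMax.deriv_deriv_nonpos ?_ ?_
  · have h' : IsLocalMax g (x + (0 : ℝ) • stdOrthonormalBasis ℝ E i) := by simpa using h
    exact IsLocalMax.comp_continuous (g := fun s : ℝ => x + s • stdOrthonormalBasis ℝ E i) h' hc
  · have h' : ContinuousAt g (x + (0 : ℝ) • stdOrthonormalBasis ℝ E i) := by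
      simpa using hg.continuousAt
    exact ContinuousAt.comp (f := fun s : ℝ => x + s • stdOrthonormalBasis ℝ E i) h' hc

/-- The Laplacian of `A (R² - |x - x₀|²)^{-k}` inside the ball of radius `R`. -/
theorem laplacian_rpow_sq_sub_norm_sq {x₀ x : E} {R : ℝ} (hx : ‖x - x₀‖ < R) (A k : ℝ) :
    Laplacian.laplacian (fun y => A * (R ^ 2 - ‖y - x₀‖ ^ 2) ^ (-k)) x =
      A * (2 * k * Module.finrank ℝ E * (R ^ 2 - ‖x - x₀‖ ^ 2) ^ (-k - 1) +
        4 * k * (k + 1) * ‖x - x₀‖ ^ 2 * (R ^ 2 - ‖x - x₀‖ ^ 2) ^ (-k - 2)) := by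
  have hpos : 0 < R ^ 2 - ‖x - x₀‖ ^ 2 := by
    have := norm_nonneg (x - x₀)
    nlinarith
  set v := stdOrthonormalBasis ℝ E with hv
  rw [(contDiffAt_rpow_sq_sub_norm_sq hx A k).laplacian_eq_sum_deriv_deriv v]
  have hline : ∀ i, deriv (deriv fun s : ℝ => A * (R ^ 2 - ‖x + s • v i - x₀‖ ^ 2) ^ (-k)) 0 =
      A * (2 * k * (R ^ 2 - ‖x - x₀‖ ^ 2) ^ (-k - 1) +
        4 * k * (k + 1) * (inner ℝ (x - x₀) (v i)) ^ 2 * (R ^ 2 - ‖x - x₀‖ ^ 2) ^ (-k - 2)) := by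
    intro i
    rw [← deriv_deriv_rpow_quadratic hpos]
    congr 2
    ext s
    have : x + s • v i - x₀ = (x - x₀) + s • v i := by abel
    rw [this, norm_add_sq_real, norm_smul, v.norm_eq_one, inner_smul_right]
    congr 2
    simp only [Real.norm_eq_abs, mul_one, sq_abs]
    ring
  simp_rw [hline]
  rw [← v.sum_sq_inner_left (x - x₀), ← Finset.mul_sum, Finset.sum_add_distrib, Finset.mul_sum,
    Finset.sum_mul]
  simp only [Finset.sum_const, Finset.card_univ, Fintype.card_fin, nsmul_eq_mul]
  ring

end Laplacian

/-! ### Comparison with blowing-up barriers -/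

theorem exists_forall_lt_mul_rpow_neg {A p : ℝ} (hA : 0 < A) (hp : 0 < p) (M : ℝ) :
    ∃ δ > 0, ∀ z, 0 < z → z < δ → M < A * z ^ (-p) := by
  have h1 := (tendsto_rpow_neg_nhdsGT_zero (neg_lt_zero.2 hp)).const_mul_atTop hA
  obtain ⟨δ, hδ, h⟩ := mem_nhdsGT_iff_exists_Ioo_subset.1 (h1.eventually_gt_atTop M)
  exact ⟨δ, hδ, fun z h0 hz => h ⟨h0, hz⟩⟩

/-- Comparison with the sum of a function of time that blows up at `t = τ` and a function of space
that blows up on the sphere of radius `R`, both being positive supersolutions. -/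
theorem IsSolution.le_add_of_blowup {N : ℕ} {Ω : Set (EuclideanSpace ℝ (Fin N))} (hΩ : IsOpen Ω)
    {T α q : ℝ} (hq : 1 < q) {u : EuclideanSpace ℝ (Fin N) → ℝ → ℝ}
    (hu : IsSolution Ω T α q u) (hu0 : VanishesOnLateralBoundary Ω T u)
    {x₀ : EuclideanSpace ℝ (Fin N)} {R τ t₀ : ℝ} (hτ : 0 < τ) (ht₀ : t₀ < T)
    {y y' : ℝ → ℝ} {w : EuclideanSpace ℝ (Fin N) → ℝ}
    (hy : ∀ t, τ < t → 0 < y t) (hyd : ∀ t, τ < t → HasDerivAt y (y' t) t)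
    (hysup : ∀ t, τ < t → -(t ^ α * y t ^ q) ≤ y' t)
    (hyblow : ∀ M, ∃ σ > τ, ∀ t, τ < t → t < σ → M < y t)
    (hw : ∀ x, ‖x - x₀‖ < R → 0 < w x) (hwd : ∀ x, ‖x - x₀‖ < R → ContDiffAt ℝ 2 w x)
    (hwsup : ∀ x, ‖x - x₀‖ < R → ∀ t ∈ Set.Icc τ t₀, Laplacian.laplacian w x ≤ t ^ α * w x ^ q)
    (hwblow : ∀ M, ∃ ρ < R, ∀ x, ρ < ‖x - x₀‖ → ‖x - x₀‖ < R → M < w x)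
    {x : EuclideanSpace ℝ (Fin N)} (hx : x ∈ Ω) (hxR : ‖x - x₀‖ < R)
    {t : ℝ} (ht : t ∈ Set.Ioc τ t₀) : u x t ≤ y t + w x := by
  by_contra! hlt
  -- Because `0 < τ` and `t₀ < T`, this closed cylinder avoids the possible singularity at `t = 0`,
  -- so `u` is bounded above on it.
  have hK₀ : IsCompact ((closure Ω ∩ Metric.closedBall x₀ R) ×ˢ Set.Icc τ t₀) :=
    ((isCompact_closedBall x₀ R).inter_left isClosed_closure).prod isCompact_Icc
  have huc : ∀ s : Set (EuclideanSpace ℝ (Fin N)), ∀ I : Set ℝ, I ⊆ Set.Icc τ t₀ →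
      ContinuousOn (fun p : EuclideanSpace ℝ (Fin N) × ℝ => u p.1 p.2) ((closure Ω ∩ s) ×ˢ I) :=
    fun s I hI => hu0.continuousOn.mono (Set.prod_mono Set.inter_subset_left
      fun r hr => ⟨hτ.trans_le (hI hr).1, (hI hr).2.trans_lt ht₀⟩)
  obtain ⟨M, hM⟩ := hK₀.bddAbove_image (huc _ _ subset_rfl)
  have hM' : ∀ x' ∈ closure Ω, ‖x' - x₀‖ < R → ∀ s ∈ Set.Ioc τ t₀, u x' s ≤ M :=
    fun x' hx' hxR' s hs => hM ⟨(x', s), ⟨⟨hx', by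
      rw [Metric.mem_closedBall, dist_eq_norm]; exact hxR'.le⟩, hs.1.le, hs.2⟩, rfl⟩
  obtain ⟨σ, hσ, hyσ⟩ := hyblow M
  obtain ⟨ρ, hρ, hwρ⟩ := hwblow M
  -- points where `u` exceeds the barrier stay away from its singular set
  set ρ' := (ρ + R) / 2 with hρ'
  set σ' := (τ + σ) / 2 with hσ'
  have hσ'τ : τ < σ' := by rw [hσ']; linarith
  have hρ'R : ρ' < R := by rw [hρ']; linarith
  have haway : ∀ x' ∈ closure Ω, ‖x' - x₀‖ < R → ∀ s ∈ Set.Ioc τ t₀, y s + w x' < u x' s →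
      ‖x' - x₀‖ < ρ' ∧ σ' < s := by
    intro x' hx' hxR' s hs hgt
    have h1 := hM' x' hx' hxR' s hs
    have h2 := hy s hs.1
    have h3 := hw x' hxR'
    constructor
    · by_contra! h
      have := hwρ x' (lt_of_lt_of_le (by rw [hρ']; linarith) h) hxR'
      linarith
    · by_contra! h
      have := hyσ s hs.1 (lt_of_le_of_lt h (by rw [hσ']; linarith))
      linarith
  have hK : IsCompact ((closure Ω ∩ Metric.closedBall x₀ ρ') ×ˢ Set.Icc σ' t₀) :=
    ((isCompact_closedBall x₀ ρ').inter_left isClosed_closure).prod isCompact_Icc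
  obtain ⟨hxρ, htσ⟩ := haway x (subset_closure hx) hxR t ht hlt
  have hmem : (x, t) ∈ (closure Ω ∩ Metric.closedBall x₀ ρ') ×ˢ Set.Icc σ' t₀ :=
    ⟨⟨subset_closure hx, by rw [Metric.mem_closedBall, dist_eq_norm]; exact hxρ.le⟩, htσ.le, ht.2⟩
  have hcont : ContinuousOn (fun p : EuclideanSpace ℝ (Fin N) × ℝ => u p.1 p.2 - (y p.2 + w p.1))
      ((closure Ω ∩ Metric.closedBall x₀ ρ') ×ˢ Set.Icc σ' t₀) := by
    refine (huc _ _ (Set.Icc_subset_Icc_left hσ'τ.le)).sub (ContinuousOn.add ?_ ?_)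
    · intro p hp
      exact ((hyd p.2 (hσ'τ.trans_le hp.2.1)).continuousAt.comp
        continuousAt_snd).continuousWithinAt
    · intro p hp
      have : ‖p.1 - x₀‖ < R := by
        have := hp.1.2
        rw [Metric.mem_closedBall, dist_eq_norm] at this
        linarith
      exact ((hwd p.1 this).continuousAt.comp continuousAt_fst).continuousWithinAt
  obtain ⟨⟨z, s⟩, ⟨⟨hzΩ, hzρ⟩, hsσ, hst⟩, hmax⟩ := hK.exists_isMaxOn ⟨_, hmem⟩ hcont
  have hmax' : ∀ z' ∈ closure Ω, ‖z' - x₀‖ ≤ ρ' → ∀ s' ∈ Set.Icc σ' t₀,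
      u z' s' - (y s' + w z') ≤ u z s - (y s + w z) := fun z' h1 h2 s' h3 =>
    hmax (show (z', s') ∈ _ from ⟨⟨h1, by rw [Metric.mem_closedBall, dist_eq_norm]; exact h2⟩, h3⟩)
  rw [Metric.mem_closedBall, dist_eq_norm] at hzρ
  simp only at hsσ hst hzΩ hzρ
  have hzR : ‖z - x₀‖ < R := by linarith
  have hτs : τ < s := hσ'τ.trans_le hsσ
  have hpos : y s + w z < u z s := by
    have := hmax' x (subset_closure hx) hxρ.le t ⟨htσ.le, ht.2⟩
    linarith
  have hys := hy s hτs
  have hwz := hw z hzR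
  -- The maximum is positive, so it is off the sphere of radius `ρ'` and off the initial time `σ'`;
  -- it may still occur at the final time `t₀`.
  obtain ⟨hzρ', hsσ'⟩ := haway z hzΩ hzR s ⟨hτs, hst⟩ hpos
  have hsT : s ∈ Set.Ioo 0 T := ⟨hτ.trans hτs, hst.trans_lt ht₀⟩
  have hz : z ∈ Ω := by
    by_contra hz
    have := hu0.eq_zero z ⟨hzΩ, by rwa [hΩ.interior_eq]⟩ s hsT
    linarith
  have huC : ContDiffAt ℝ 2 (fun x' => u x' s) z :=
    (hu.isC21.contDiffOn_space s hsT).contDiffAt (hΩ.mem_nhds hz)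
  have hlap : Laplacian.laplacian (fun x' => u x' s) z ≤ Laplacian.laplacian w z := by
    have hloc : IsLocalMax ((fun x' => u x' s) - w) z := by
      have hball : ∀ᶠ z' in nhds z, ‖z' - x₀‖ < ρ' :=
        (continuous_id.sub continuous_const).norm.continuousAt.eventually (gt_mem_nhds hzρ')
      filter_upwards [hΩ.mem_nhds hz, hball] with z' h1 h2
      have := hmax' z' (subset_closure h1) h2.le s ⟨hsσ, hst⟩
      simp only [Pi.sub_apply]
      linarith
    have := hloc.laplacian_nonpos (huC.sub (hwd z hzR))
    rw [huC.laplacian_sub (hwd z hzR)] at this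
    linarith
  -- Only earlier times are compared, since `s = t₀` is possible.
  have htime : y' s ≤ deriv (fun r => u z r) s := by
    have hd := (hu.isC21.differentiableAt_time z hz s hsT).hasDerivAt.sub (hyd s hτs)
    have := hd.nonneg_of_eventually_nhdsLT_le (by
      filter_upwards [Ioo_mem_nhdsLT hsσ'] with r hr
      have := hmax' z hzΩ hzρ r ⟨hr.1.le, hr.2.le.trans hst⟩
      simp only [Pi.sub_apply]
      linarith)
    linarith
  have heq := hu.equation z hz s hsT
  have hupos : 0 < u z s := by linarith
  have hpow : |u z s| ^ (q - 1) * u z s = u z s ^ q := by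
    rw [abs_of_pos hupos]
    nth_rewrite 2 [← Real.rpow_one (u z s)]
    rw [← Real.rpow_add hupos]
    congr 1
    ring
  rw [mul_assoc, hpow] at heq
  -- The absorption term is strictly larger for `u` than for the barriers, so no perturbation is
  -- needed: `∂_t u - Δu ≥ y' - Δw ≥ -s^α (y^q + w^q) > -s^α u^q`, against the equation.
  have hsup : y s ^ q + w z ^ q < u z s ^ q :=
    (Real.add_rpow_le_rpow_add hys.le hwz.le hq.le).trans_lt
      (Real.rpow_lt_rpow (by linarith) hpos (by linarith))
  have hsα : 0 < s ^ α := Real.rpow_pos_of_pos hsT.1 α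
  have h1 := hysup s hτs
  have h2 := hwsup z hzR s ⟨hτs.le, hst⟩
  have h3 := mul_lt_mul_of_pos_left hsup hsα
  rw [mul_add] at h3
  linarith

/-! ### The two barriers and the limits `R → ∞`, `τ → 0` -/

/-- The solution of `y' + t^α y^q = 0` that blows up at `t = τ`. -/
theorem hasDerivAt_blowup_ode {α q τ t : ℝ} (hα : -1 < α) (hq : 1 < q) (hτ : 0 < τ) (ht : τ < t) :
    HasDerivAt
      (fun s : ℝ => ((1 + α) / (q - 1)) ^ (1 / (q - 1)) *
        (s ^ (1 + α) - τ ^ (1 + α)) ^ (-(1 / (q - 1))))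
      (-(t ^ α * (((1 + α) / (q - 1)) ^ (1 / (q - 1)) *
        (t ^ (1 + α) - τ ^ (1 + α)) ^ (-(1 / (q - 1)))) ^ q)) t := by
  have hq1 : 0 < q - 1 := by linarith
  have hB : 0 < (1 + α) / (q - 1) := div_pos (by linarith) hq1
  have hz : 0 < t ^ (1 + α) - τ ^ (1 + α) :=
    sub_pos.2 (Real.rpow_lt_rpow hτ.le ht (by linarith))
  have h1 : HasDerivAt (fun s : ℝ => s ^ (1 + α) - τ ^ (1 + α)) ((1 + α) * t ^ (1 + α - 1)) t :=
    (Real.hasDerivAt_rpow_const (Or.inl (hτ.trans ht).ne')).sub_const _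
  have h2 := (h1.rpow_const (p := -(1 / (q - 1))) (Or.inl hz.ne')).const_mul
    (((1 + α) / (q - 1)) ^ (1 / (q - 1)))
  convert! h2 using 1
  rw [Real.mul_rpow (by positivity) (by positivity), ← Real.rpow_mul hB.le, ← Real.rpow_mul hz.le]
  have e1 : 1 / (q - 1) * q = 1 / (q - 1) + 1 := by field_simp; ring
  have e2 : -(1 / (q - 1)) * q = -(1 / (q - 1)) - 1 := by rw [neg_mul, e1]; ring
  have e3 : 1 + α - 1 = α := by ring
  rw [e1, e2, e3, Real.rpow_add hB, Real.rpow_one]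
  ring

/-- A Keller–Osserman barrier: `A (R² - |x - x₀|²)^{-2/(q-1)}` is a supersolution of
`-Δ w + c w^q = 0` when `A^{q-1}` is a suitable multiple of `R² / c`. -/
theorem laplacian_kellerOsserman_le {E : Type*} [NormedAddCommGroup E] [InnerProductSpace ℝ E]
    [FiniteDimensional ℝ E] {x₀ x : E} {R A c k q : ℝ} (hx : ‖x - x₀‖ < R) (hA : 0 < A)
    (hk : 0 < k) (hkq : k * q = k + 2)
    (hAc : c * A ^ (q - 1) = (2 * k * Module.finrank ℝ E + 4 * k * (k + 1)) * R ^ 2) :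
    Laplacian.laplacian (fun y => A * (R ^ 2 - ‖y - x₀‖ ^ 2) ^ (-k)) x ≤
      c * (A * (R ^ 2 - ‖x - x₀‖ ^ 2) ^ (-k)) ^ q := by
  have hφ : 0 < R ^ 2 - ‖x - x₀‖ ^ 2 := by
    have := norm_nonneg (x - x₀)
    nlinarith
  rw [laplacian_rpow_sq_sub_norm_sq hx, Real.mul_rpow hA.le (by positivity), ← Real.rpow_mul hφ.le]
  have e1 : -k * q = -k - 2 := by rw [neg_mul, hkq]; ring
  have e2 : A ^ q = A * A ^ (q - 1) := by
    rw [← Real.rpow_one_add' hA.le (by intro h; have : q = 0 := by linarith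
                                       rw [this] at hkq; linarith)]
    congr 1
    ring
  have e3 : (R ^ 2 - ‖x - x₀‖ ^ 2) ^ (-k - 1) =
      (R ^ 2 - ‖x - x₀‖ ^ 2) * (R ^ 2 - ‖x - x₀‖ ^ 2) ^ (-k - 2) := by
    have : -k - 1 = 1 + (-k - 2) := by ring
    rw [this, Real.rpow_add hφ, Real.rpow_one]
  rw [e1, e2, e3]
  set P := (R ^ 2 - ‖x - x₀‖ ^ 2) ^ (-k - 2) with hP
  have hPpos : 0 < P := Real.rpow_pos_of_pos hφ _
  calc A * (2 * k * Module.finrank ℝ E * ((R ^ 2 - ‖x - x₀‖ ^ 2) * P) +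
        4 * k * (k + 1) * ‖x - x₀‖ ^ 2 * P)
      = A * P * (2 * k * Module.finrank ℝ E * (R ^ 2 - ‖x - x₀‖ ^ 2) +
        4 * k * (k + 1) * ‖x - x₀‖ ^ 2) := by ring
    -- Both `R² - |x - x₀|²` and `|x - x₀|²` are at most `R²`; this fixes the constant in `hAc`.
    _ ≤ A * P * (2 * k * Module.finrank ℝ E * R ^ 2 + 4 * k * (k + 1) * R ^ 2) := by
        have h1 : R ^ 2 - ‖x - x₀‖ ^ 2 ≤ R ^ 2 := by linarith [sq_nonneg ‖x - x₀‖]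
        have h2 : ‖x - x₀‖ ^ 2 ≤ R ^ 2 := by linarith
        gcongr
    _ = A * P * (c * A ^ (q - 1)) := by rw [hAc]; ring
    _ = c * (A * A ^ (q - 1) * P) := by ring

open Filter Topology in
/-- The bound by the solution of the ODE that blows up at a positive time `τ`. -/
theorem IsSolution.le_blowup_ode {N : ℕ} {Ω : Set (EuclideanSpace ℝ (Fin N))} (hΩ : IsOpen Ω)
    {T α q : ℝ} (hα : -1 < α) (hq : 1 < q) {u : EuclideanSpace ℝ (Fin N) → ℝ → ℝ}
    (hu : IsSolution Ω T α q u) (hu0 : VanishesOnLateralBoundary Ω T u)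
    {x : EuclideanSpace ℝ (Fin N)} (hx : x ∈ Ω) {τ t : ℝ} (hτ : 0 < τ) (hτt : τ < t) (htT : t < T) :
    u x t ≤ ((1 + α) / (q - 1)) ^ (1 / (q - 1)) *
        (t ^ (1 + α) - τ ^ (1 + α)) ^ (-(1 / (q - 1))) := by
  have hq1 : 0 < q - 1 := by linarith
  have hα1 : 0 < 1 + α := by linarith
  set m := 1 / (q - 1) with hm
  have hmpos : 0 < m := by positivity
  set D := ((1 + α) / (q - 1)) ^ m with hD
  have hDpos : 0 < D := Real.rpow_pos_of_pos (by positivity) _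
  have hz : ∀ s, τ < s → 0 < s ^ (1 + α) - τ ^ (1 + α) := fun s hs =>
    sub_pos.2 (Real.rpow_lt_rpow hτ.le hs hα1)
  -- A positive lower bound for `s^α`, whatever the sign of `α`, lets one time-independent `w` serve
  -- on all of `[τ, t]`.
  obtain ⟨c, hc, hcα⟩ : ∃ c > 0, ∀ s ∈ Set.Icc τ t, c ≤ s ^ α := by
    obtain ⟨s₀, hs₀, hmin⟩ := isCompact_Icc.exists_isMinOn (Set.nonempty_Icc.2 hτt.le)
      (continuousOn_id.rpow_const (p := α) fun s (hs : s ∈ Set.Icc τ t) =>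
        Or.inl (hτ.trans_le hs.1).ne')
    exact ⟨s₀ ^ α, Real.rpow_pos_of_pos (hτ.trans_le hs₀.1) _, fun s hs => hmin hs⟩
  set k := 2 * m with hk
  have hkpos : 0 < k := by positivity
  set C := 2 * k * Module.finrank ℝ (EuclideanSpace ℝ (Fin N)) + 4 * k * (k + 1) with hC
  have hCpos : 0 < C := by positivity
  have hkq : k * q = k + 2 := by rw [hk, hm]; field_simp; ring
  have key : ∀ R : ℝ, 0 < R →
      u x t ≤ D * (t ^ (1 + α) - τ ^ (1 + α)) ^ (-m) + (C / c) ^ m * (R ^ 2) ^ (-m) := by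
    intro R hR
    set A := (C * R ^ 2 / c) ^ m with hA
    have hApos : 0 < A := Real.rpow_pos_of_pos (by positivity) _
    have hAq : c * A ^ (q - 1) = C * R ^ 2 := by
      rw [hA, ← Real.rpow_mul (by positivity), hm, one_div, inv_mul_cancel₀ hq1.ne', Real.rpow_one]
      field_simp
    have hφ : ∀ x' : EuclideanSpace ℝ (Fin N), ‖x' - x‖ < R → 0 < R ^ 2 - ‖x' - x‖ ^ 2 := by
      intro x' hx'
      have := norm_nonneg (x' - x)
      nlinarith
    have h := hu.le_add_of_blowup hΩ hq hu0 (x₀ := x) (R := R) hτ htT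
      (y := fun s => D * (s ^ (1 + α) - τ ^ (1 + α)) ^ (-m))
      (w := fun x' => A * (R ^ 2 - ‖x' - x‖ ^ 2) ^ (-k))
      (fun s hs => mul_pos hDpos (Real.rpow_pos_of_pos (hz s hs) _))
      (fun s hs => hasDerivAt_blowup_ode hα hq hτ hs) (fun s hs => le_rfl)
      (fun M => by
        obtain ⟨δ, hδ, hM⟩ := exists_forall_lt_mul_rpow_neg hDpos hmpos M
        have hcz : ContinuousAt (fun s : ℝ => s ^ (1 + α) - τ ^ (1 + α)) τ :=
          (Real.continuousAt_rpow_const _ _ (Or.inl hτ.ne')).sub continuousAt_const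
        have hev : ∀ᶠ s in 𝓝[>] τ, s ^ (1 + α) - τ ^ (1 + α) < δ :=
          (hcz.eventually (gt_mem_nhds (by simpa using hδ))).filter_mono nhdsWithin_le_nhds
        obtain ⟨σ, hσ, hsub⟩ := mem_nhdsGT_iff_exists_Ioo_subset.1 hev
        exact ⟨σ, hσ, fun s h1 h2 => hM _ (hz s h1) (hsub ⟨h1, h2⟩)⟩)
      (fun x' hx' => mul_pos hApos (Real.rpow_pos_of_pos (hφ x' hx') _))
      (fun x' hx' => contDiffAt_rpow_sq_sub_norm_sq hx' A k)
      (fun x' hx' s hs => (laplacian_kellerOsserman_le hx' hApos hkpos hkq hAq).trans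
        (mul_le_mul_of_nonneg_right (hcα s hs)
          (Real.rpow_nonneg (mul_pos hApos (Real.rpow_pos_of_pos (hφ x' hx') _)).le _)))
      (fun M => by
        obtain ⟨δ, hδ, hM⟩ := exists_forall_lt_mul_rpow_neg hApos hkpos M
        -- For `r = |x' - x| < R`, `R² - r² = (R - r)(R + r) < (δ / (2R)) · 2R = δ`.
        refine ⟨R - δ / (2 * R), by linarith [show 0 < δ / (2 * R) by positivity],
          fun x' h1 h2 => hM _ (hφ x' h2) ?_⟩
        have h3 : R - ‖x' - x‖ < δ / (2 * R) := by linarith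
        rw [lt_div_iff₀ (by positivity)] at h3
        have := norm_nonneg (x' - x)
        nlinarith)
      hx (by simpa using hR) ⟨hτt, le_rfl⟩
    -- At the centre, `A` grows like `R^(2m)` against `R^(-2k) = R^(-4m)`, so the value decays like
    -- `R^(-2m)`.
    have hval : A * (R ^ 2 - ‖x - x‖ ^ 2) ^ (-k) = (C / c) ^ m * (R ^ 2) ^ (-m) := by
      have e1 : C * R ^ 2 / c = C / c * R ^ 2 := by ring
      have e2 : -m = m + -k := by rw [hk]; ring
      rw [hA, e1, Real.mul_rpow (by positivity) (by positivity), e2, Real.rpow_add (by positivity)]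
      simp [mul_assoc]
    rwa [hval] at h
  have hlim : Tendsto (fun R : ℝ =>
      D * (t ^ (1 + α) - τ ^ (1 + α)) ^ (-m) + (C / c) ^ m * (R ^ 2) ^ (-m)) atTop
      (𝓝 (D * (t ^ (1 + α) - τ ^ (1 + α)) ^ (-m))) := by
    have := (((tendsto_rpow_neg_atTop hmpos).comp
      (tendsto_pow_atTop (α := ℝ) two_ne_zero)).const_mul ((C / c) ^ m)).const_add
      (D * (t ^ (1 + α) - τ ^ (1 + α)) ^ (-m))
    simpa using this
  exact ge_of_tendsto hlim ((eventually_gt_atTop 0).mono key)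

theorem proposition4p1 {N : ℕ} (Ω : Set (EuclideanSpace ℝ (Fin N))) (hΩ : IsOpen Ω)
    (T α q : ℝ) (hT : 0 < T) (hα : -1 < α) (hq : 1 < q)
    (u : EuclideanSpace ℝ (Fin N) → ℝ → ℝ)
    (hu : IsSolution Ω T α q u) (hu0 : VanishesOnLateralBoundary Ω T u) :
    ∀ x ∈ Ω, ∀ t ∈ Set.Ioo 0 T,
      u x t ≤ ((1 + α) / (q - 1)) ^ (1 / (q - 1)) * t ^ (-((1 + α) / (q - 1))) := by
  intro x hx t ht
  have hα1 : 0 < 1 + α := by linarith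
  have htpos : 0 < t ^ (1 + α) := Real.rpow_pos_of_pos ht.1 _
  -- `α > -1` enters here: `τ^(1+α) → 0`, so the blow-up time can be moved to `0`.
  have h0 : Filter.Tendsto (fun τ : ℝ => τ ^ (1 + α)) (nhdsWithin 0 (Set.Ioi 0)) (nhds 0) := by
    have := (Real.continuousAt_rpow_const 0 (1 + α) (Or.inr hα1.le)).tendsto
    rw [Real.zero_rpow hα1.ne'] at this
    exact this.mono_left nhdsWithin_le_nhds
  have hlim := ((h0.const_sub (t ^ (1 + α))).rpow_const (p := -(1 / (q - 1)))
    (Or.inl (by simpa using htpos.ne'))).const_mul (((1 + α) / (q - 1)) ^ (1 / (q - 1)))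
  have hexp : (t ^ (1 + α) - 0) ^ (-(1 / (q - 1))) = t ^ (-((1 + α) / (q - 1))) := by
    rw [sub_zero, ← Real.rpow_mul ht.1.le]
    congr 1
    ring
  rw [hexp] at hlim
  refine ge_of_tendsto hlim ?_
  filter_upwards [Ioo_mem_nhdsGT ht.1] with τ hτ
  exact hu.le_blowup_ode hΩ hα hq hu0 hx hτ.1 hτ.2 ht.2
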